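/- All graphs are finite, simple and undirected. For a graph $G$ let $\omega(G)$ denote the number of its connected components, and for $S\subseteq V(G)$ let $G-S$ be the subgraph induced on $V(G)\setminus S$. For a real number $t$, the graph $G$ is called $t$-tough if $|S|\ge t\cdot\omega(G-S)$ for every $S\subseteq V(G)$ with $\omega(G-S)>1$. The graph $2K_2$ consists of four vertices and two disjoint edges, and $G$ is $2K_2$-free if it does not contain $2K_2$ as an induced subgraph. $G$ is Hamiltonian if it contains a cycle through all of its vertices. **Theorem.** Every $2$-tough $2K_2$-free graph on at least three vertices is Hamiltonian. -/

import Mathlib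

/-- The number `ω(G)` of connected components of a (finite) graph. -/
noncomputable def numComponents {V : Type*} (G : SimpleGraph V) : ℕ :=
  Nat.card G.ConnectedComponent

/-- `G` is `t`-tough: `|S| ≥ t · ω(G - S)` for every set `S` of vertices with `ω(G - S) > 1`,
where `G - S` is the subgraph induced on the complement of `S`. -/
def IsTough {V : Type*} (t : ℝ) (G : SimpleGraph V) : Prop :=
  ∀ S : Finset V, 1 < numComponents (G.induce {v | v ∉ S}) →
    t * (numComponents (G.induce {v | v ∉ S}) : ℝ) ≤ (S.card : ℝ)

/-- The graph `2K₂`: the disjoint union of two copies of `K₂`. -/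
def twoKTwo : SimpleGraph (Fin 2 ⊕ Fin 2) :=
  SimpleGraph.sum (SimpleGraph.completeGraph (Fin 2)) (SimpleGraph.completeGraph (Fin 2))

/-- `G` is `2K₂`-free: `2K₂` is not an induced subgraph of `G`. -/
def IsTwoKTwoFree {V : Type*} (G : SimpleGraph V) : Prop :=
  ¬ SimpleGraph.IsIndContained twoKTwo G

open SimpleGraph

/-! ### Consequences of toughness and of 2K₂-freeness. -/

section Toughness

variable {V : Type*} {G : SimpleGraph V}

/-! Let `G` be a counterexample on `n` vertices and fix a longest path ending in `b, a`. Closing it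
is impossible, so Pósa rotations at its head never disturb `b, a`, and no rotation end is `a` or
adjacent to `a`. If the set `R` of rotation ends were independent, Pósa's lemma would give `|N(R)| ≤
2|R|`, while deleting `N(R)` separates `R` and `a` into at least `|R| + 1` components, against
2-toughness. So `R` contains an edge `r₁r₂`.

Comparing it with `ab`, 2K₂-freeness makes `b` adjacent to some end; this closes a cycle through
everything on the path but `a`. The cyclic successors of the neighbours of `a`, with `a`, are then
independent, so `deg a + 1 ≤ n/3`. Reversing paths, this bounds the degree of every rotation end.
The common non-neighbours of `r₁` and `r₂` are independent by 2K₂-freeness, so at most `n/3`, and `n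
≤ n/3 + 2(n/3 - 1)` is absurd. -/

theorem IsTwoKTwoFree.adj_of_adj (hfree : IsTwoKTwoFree G) {a b c d : V}
    (hab : G.Adj a b) (hcd : G.Adj c d) (hac : a ≠ c) (had : a ≠ d) (hbc : b ≠ c) (hbd : b ≠ d) :
    G.Adj a c ∨ G.Adj a d ∨ G.Adj b c ∨ G.Adj b d := by
  by_contra! h
  obtain ⟨h1, h2, h3, h4⟩ := h
  refine hfree ⟨⟨⟨Sum.elim ![a, b] ![c, d], ?_⟩, ?_⟩⟩
  · have := hab.ne
    have := hcd.ne
    rintro (i | i) (j | j) <;> fin_cases i <;> fin_cases j <;> simp_all [eq_comm]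
  · intro i j
    change G.Adj (Sum.elim ![a, b] ![c, d] i) (Sum.elim ![a, b] ![c, d] j) ↔ _
    rcases i with i | i <;> rcases j with j | j <;> fin_cases i <;> fin_cases j <;>
      simp_all [twoKTwo, SimpleGraph.adj_comm]

variable [Fintype V] [DecidableEq V]

theorem IsTough.two_mul_card_le (htough : IsTough 2 G) {S I : Finset V} (hI : 2 ≤ I.card)
    (hIS : ∀ x ∈ I, x ∉ S)
    (hsep : ∀ (x) (hx : x ∈ I) (y) (hy : y ∈ I), x ≠ y →
      ¬ (G.induce {v | v ∉ S}).Reachable ⟨x, hIS x hx⟩ ⟨y, hIS y hy⟩) :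
    2 * I.card ≤ S.card := by
  classical
  have hle : I.card ≤ numComponents (G.induce {v | v ∉ S}) := by
    let f : I → (G.induce {v | v ∉ S}).ConnectedComponent :=
      fun x => (G.induce {v | v ∉ S}).connectedComponentMk ⟨x.1, hIS x.1 x.2⟩
    have hf : Function.Injective f := by
      intro x y hxy
      by_contra hne
      exact hsep x.1 x.2 y.1 y.2 (fun h => hne (Subtype.ext h)) (ConnectedComponent.exact hxy)
    have := Nat.card_le_card_of_injective f hf
    simpa [numComponents] using this
  have h := htough S (by omega)
  have h' : (2 * numComponents (G.induce {v | v ∉ S}) : ℕ) ≤ S.card := by exact_mod_cast h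
  omega

/-- Every vertex of `I` except possibly `a` is isolated after deleting `S`, so the vertices of `I`
lie in distinct components. The exception lets `a` count as one more component, whatever its
neighbours. -/
theorem IsTough.two_mul_card_le_of_forall_neighbor (htough : IsTough 2 G) {S I : Finset V} (a : V)
    (hI : 2 ≤ I.card) (hIS : ∀ x ∈ I, x ∉ S)
    (hnbr : ∀ x ∈ I, x ≠ a → ∀ y, G.Adj x y → y ∈ S) :
    2 * I.card ≤ S.card := by
  refine htough.two_mul_card_le hI hIS ?_
  have key : ∀ (x) (hx : x ∈ I) (y) (hy : y ∈ I), x ≠ y → x ≠ a →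
      ¬ (G.induce {v | v ∉ S}).Reachable ⟨x, hIS x hx⟩ ⟨y, hIS y hy⟩ := by
    rintro x hx y hy hxy hxa ⟨p⟩
    obtain ⟨d, -, hd1, hd2⟩ := p.exists_boundary_dart {⟨x, hIS x hx⟩} (by simp)
      (by simpa using fun h => hxy h.symm)
    have hadj := d.adj
    rw [Set.mem_singleton_iff.1 hd1] at hadj
    exact d.snd.2 (hnbr x hx hxa _ hadj)
  intro x hx y hy hxy
  by_cases hxa : x = a
  · intro h
    exact key y hy x hx hxy.symm (by rintro rfl; exact hxy hxa) h.symm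
  · exact key x hx y hy hxy hxa

theorem IsTough.three_mul_card_le (htough : IsTough 2 G) (hcard : 3 ≤ Fintype.card V)
    {I : Finset V} (hI : ∀ x ∈ I, ∀ y ∈ I, ¬ G.Adj x y) : 3 * I.card ≤ Fintype.card V := by
  by_cases h2 : 2 ≤ I.card
  · obtain ⟨a, -⟩ := Finset.card_pos.1 (by omega : 0 < I.card)
    have := htough.two_mul_card_le_of_forall_neighbor (S := Iᶜ) a h2 (by simp) (by
      intro x hx _ y hxy
      rw [Finset.mem_compl]
      exact fun hy => hI x hx y hy hxy)
    rw [Finset.card_compl] at this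
    have := Finset.card_le_univ I
    omega
  · omega

theorem IsTough.exists_adj_of_mem_of_notMem (htough : IsTough 2 G) {U : Set V} {x y : V}
    (hx : x ∈ U) (hy : y ∉ U) : ∃ u ∈ U, ∃ v ∉ U, G.Adj u v := by
  by_contra! h
  have hxy : x ≠ y := by rintro rfl; exact hy hx
  have key : ¬ (G.induce {v | v ∉ (∅ : Finset V)}).Reachable ⟨x, by simp⟩ ⟨y, by simp⟩ := by
    rintro ⟨p⟩
    obtain ⟨d, -, hd1, hd2⟩ := p.exists_boundary_dart {v | v.1 ∈ U} hx hy
    exact h _ hd1 _ hd2 d.adj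
  have := htough.two_mul_card_le (S := ∅) (I := {x, y}) (by rw [Finset.card_pair hxy]) (by simp) (by
    intro u hu v hv huv
    rw [Finset.mem_insert, Finset.mem_singleton] at hu hv
    rcases hu with rfl | rfl <;> rcases hv with rfl | rfl
    · exact absurd rfl huv
    · exact key
    · exact fun h => key h.symm
    · exact absurd rfl huv)
  rw [Finset.card_pair hxy] at this
  simp at this

end Toughness

/-! ### Longest paths cannot be closed up. -/

section LongestPath

variable {V : Type*} {G : SimpleGraph V}

/-- `l` is the list of vertices of a path of maximum length in `G`. -/
def IsLongestPath (G : SimpleGraph V) (l : List V) : Prop :=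
  l.Nodup ∧ l.IsChain G.Adj ∧ ∀ l' : List V, l'.Nodup → l'.IsChain G.Adj → l'.length ≤ l.length

namespace IsLongestPath

variable {l : List V}

theorem of_perm (hl : IsLongestPath G l) {l' : List V} (hp : l'.Perm l)
    (hc : l'.IsChain G.Adj) : IsLongestPath G l' :=
  ⟨hp.nodup_iff.2 hl.1, hc, fun k hk hk' => (hl.2.2 k hk hk').trans hp.length_eq.ge⟩

theorem reverse (hl : IsLongestPath G l) : IsLongestPath G l.reverse :=
  hl.of_perm l.reverse_perm (by
    rw [List.isChain_reverse]
    exact hl.2.1.imp fun _ _ h => h.symm)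

theorem mem_of_adj_head (hl : IsLongestPath G l) {x y : V} (hx : x ∈ l.head?) (h : G.Adj x y) :
    y ∈ l := by
  by_contra hy
  have := hl.2.2 (y :: l) (List.nodup_cons.2 ⟨hy, hl.1⟩)
    (List.isChain_cons.2 ⟨fun z hz => by
      rw [Option.mem_unique hz hx]
      exact h.symm, hl.2.1⟩)
  simp at this

theorem mem_of_adj_getLast (hl : IsLongestPath G l) {x y : V} (hx : x ∈ l.getLast?)
    (h : G.Adj x y) : y ∈ l := by
  have := hl.reverse.mem_of_adj_head (x := x) (by simpa using hx) h
  simpa using this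

theorem exists_of_fintype [Fintype V] (G : SimpleGraph V) : ∃ l, IsLongestPath G l := by
  classical
  have hbd : ∃ n, ∀ l : List V, l.Nodup ∧ l.IsChain G.Adj → l.length ≤ n :=
    ⟨Fintype.card V, fun l hl => hl.1.length_le_card⟩
  obtain ⟨l, hl, hmax⟩ : ∃ l : List V, (l.Nodup ∧ l.IsChain G.Adj) ∧
      l.length = Nat.find hbd := by
    by_contra! h
    have h0 : Nat.find hbd ≠ 0 := fun h0 => h [] (by simp) h0.symm
    refine Nat.find_min hbd (Nat.sub_one_lt h0) fun l hl => ?_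
    have := Nat.find_spec hbd l hl
    have := h l hl
    omega
  exact ⟨l, hl.1, hl.2, fun k hk hk' => hmax ▸ Nat.find_spec hbd k ⟨hk, hk'⟩⟩

variable [Fintype V] [DecidableEq V]

/-- A closing edge gives a cycle. Either it is Hamiltonian, or connectedness provides an edge
leaving it, and opening the cycle there yields a longer path. -/
theorem not_adj_head_getLast (hcard : 3 ≤ Fintype.card V) (htough : IsTough 2 G)
    (hham : ¬ G.IsHamiltonian) (hl : IsLongestPath G l) {x y : V} (hx : x ∈ l.head?)
    (hy : y ∈ l.getLast?) : ¬ G.Adj x y := by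
  intro hxy
  by_cases hall : ∀ v, v ∈ l
  · refine hham fun _ => ?_
    have hne : l ≠ [] := by rintro rfl; simp at hx
    have hlen : l.length = Fintype.card V := by
      rw [← List.toFinset_card_of_nodup hl.1, ← Finset.card_univ]
      congr 1
      ext v
      simp [hall]
    obtain ⟨p, hp⟩ : ∃ p : G.Walk x y, p.support = l := by
      obtain rfl : l.head hne = x := by
        rw [List.head?_eq_some_head hne] at hx; simpa using hx
      obtain rfl : l.getLast hne = y := by
        rw [List.getLast?_eq_some_getLast hne] at hy; simpa using hy
      exact ⟨Walk.ofSupport l hne hl.2.1, Walk.support_ofSupport hne hl.2.1⟩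
    have hplen : p.length + 1 = Fintype.card V := by
      rw [← Walk.length_support, hp, hlen]
    refine ⟨y, Walk.cons hxy.symm p, ?_⟩
    rw [Walk.isHamiltonianCycle_iff_isCycle_and_length_eq,
      Walk.isCycle_iff_isPath_tail_and_le_length]
    refine ⟨⟨?_, ?_⟩, ?_⟩
    · simpa [Walk.isPath_def, hp] using hl.1
    · rw [Walk.length_cons]; omega
    · rw [Walk.length_cons]; omega
  · push Not at hall
    obtain ⟨w, hw⟩ := hall
    obtain ⟨u, hu, v, hv, huv⟩ := htough.exists_adj_of_mem_of_notMem (U := {v | v ∈ l})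
      (x := x) (y := w) (List.mem_of_mem_head? hx) hw
    obtain ⟨l₁, l₂, rfl⟩ := List.append_of_mem hu
    have hperm : (u :: l₂ ++ l₁).Perm (l₁ ++ u :: l₂) := List.perm_append_comm
    refine hv (hperm.mem_iff.1 ((hl.of_perm hperm ?_).mem_of_adj_head (x := u) (by simp) huv))
    have hch := List.isChain_append.1 hl.2.1
    refine List.isChain_append.2 ⟨hch.2.1, hch.1, fun a ha b hb => ?_⟩
    have h1 : y = a := Option.mem_unique hy (by rw [List.getLast?_append]; simp [Option.mem_def.1 ha])
    have h2 : x = b := Option.mem_unique hx (by rw [List.head?_append]; simp [Option.mem_def.1 hb])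
    exact h1 ▸ h2 ▸ hxy.symm

end IsLongestPath

end LongestPath

/-! ### Pósa rotations and their end vertices. -/

section Rotation

variable {V : Type*} {G : SimpleGraph V}

/-- `l'` arises from the path `l` by a Pósa rotation at the head of `l`. -/
def IsRotation (G : SimpleGraph V) (l l' : List V) : Prop :=
  ∃ r m t k, l = (r :: m) ++ t :: k ∧ G.Adj r t ∧ l' = (r :: m).reverse ++ t :: k

theorem IsRotation.perm {l l' : List V} (h : IsRotation G l l') : l'.Perm l := by
  obtain ⟨r, m, t, k, rfl, -, rfl⟩ := h
  exact (List.reverse_perm _).append_right _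

/-- A rotation replaces just one consecutive pair, `s t` by `r t`. The relation `S` is kept general
so that invariants other than adjacency can be carried along. -/
theorem IsRotation.isChain {l l' : List V} {S : V → V → Prop} (hS : ∀ ⦃x y⦄, S x y → S y x)
    (h : IsRotation G l l') (hl : l.IsChain S)
    (hadj : ∀ r ∈ l.head?, ∀ s ∈ l'.head?, ∀ t, G.Adj r t → S s t → S r t) : l'.IsChain S := by
  obtain ⟨r, m, t, k, rfl, hrt, rfl⟩ := h
  rw [List.isChain_append] at hl ⊢
  refine ⟨?_, hl.2.1, ?_⟩
  · rw [List.isChain_reverse]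
    exact hl.1.imp fun _ _ h => hS h
  · intro x hx y hy
    rw [List.getLast?_reverse] at hx
    simp only [List.head?_cons, Option.mem_some_iff] at hx hy
    subst hx hy
    obtain ⟨s, hs⟩ : ∃ s, (r :: m).getLast? = some s :=
      ⟨_, List.getLast?_eq_some_getLast (List.cons_ne_nil r m)⟩
    refine hadj r (by simp) s ?_ t hrt (hl.2.2 s hs t (by simp))
    rw [List.head?_append, List.head?_reverse, hs]
    simp

theorem IsRotation.isLongestPath {l l' : List V} (h : IsRotation G l l')
    (hl : IsLongestPath G l) : IsLongestPath G l' :=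
  hl.of_perm h.perm (h.isChain (fun _ _ h => h.symm) hl.2.1 (by
    intro r hr s _ t hrt _
    exact hrt))

/-- The end vertices of the paths reached from `l` by rotations at the head. -/
def rotationEnds (G : SimpleGraph V) (l : List V) : Set V :=
  {v | ∃ l', Relation.ReflTransGen (IsRotation G) l l' ∧ v ∈ l'.head?}

theorem IsLongestPath.of_rotations {l l' : List V} (hl : IsLongestPath G l)
    (h : Relation.ReflTransGen (IsRotation G) l l') : IsLongestPath G l' := by
  induction h with
  | refl => exact hl
  | tail _ h ih => exact h.isLongestPath ih

variable [DecidableEq V]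

theorem List.Nodup.isChain_formPerm {l : List V} (hl : l.Nodup) :
    l.IsChain (fun x y => y = l.formPerm x) := by
  rw [List.isChain_iff_getElem]
  intro i hi
  exact (List.formPerm_apply_lt_getElem l hl i hi).symm

/-- Pósa's lemma: a neighbour of a rotation end `r` is itself a rotation end or is next to one on
the initial path. -/
theorem IsLongestPath.exists_formPerm_of_adj {l : List V} (hl : IsLongestPath G l) {r t : V}
    (hr : r ∈ rotationEnds G l) (hrt : G.Adj r t) :
    t ∈ rotationEnds G l ∨ ∃ s ∈ rotationEnds G l, t = l.formPerm s ∨ s = l.formPerm t := by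
  by_contra! ht
  obtain ⟨htR, hts⟩ := ht
  -- Invariant: on every rotated path, the neighbours of `t` along the path are neighbours of `t` on
  -- `l` (cyclically). Breaking a pair `s t` would make `s` an end.
  set S : V → V → Prop := fun x y =>
    (x = t → y = l.formPerm x ∨ x = l.formPerm y) ∧
      (y = t → y = l.formPerm x ∨ x = l.formPerm y) with hS
  have hsymm : ∀ ⦃x y⦄, S x y → S y x := fun x y h => ⟨fun e => (h.2 e).symm, fun e => (h.1 e).symm⟩
  have hST : ∀ s ∈ rotationEnds G l, ¬ S s t := fun s hs h =>
    (h.2 rfl).elim (hts s hs).1 (hts s hs).2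
  have key : ∀ l', Relation.ReflTransGen (IsRotation G) l l' → l'.IsChain S := by
    intro l' h
    induction h with
    | refl => exact hl.1.isChain_formPerm.imp fun x y h => ⟨fun _ => .inl h, fun _ => .inl h⟩
    | @tail l₁ l₂ h₁ h₂ ih =>
      refine h₂.isChain hsymm ih fun r hr s hs u _ hsu => ⟨?_, ?_⟩
      · rintro rfl
        exact absurd ⟨l₁, h₁, hr⟩ htR
      · rintro rfl
        exact absurd hsu (hST s ⟨l₂, h₁.tail h₂, hs⟩)
  obtain ⟨l', hl', hrl'⟩ := hr
  have hlong := hl.of_rotations hl'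
  obtain ⟨m, rfl⟩ : ∃ m, l' = r :: m := by
    cases l' with
    | nil => simp at hrl'
    | cons x m => exact ⟨m, by simpa using hrl'⟩
  have htm : t ∈ m := by
    rcases List.mem_cons.1 (hlong.mem_of_adj_head (by simp) hrt) with h | h
    · exact absurd h hrt.ne'
    · exact h
  obtain ⟨m₁, k, rfl⟩ := List.append_of_mem htm
  have hrot : IsRotation G (r :: (m₁ ++ t :: k)) ((r :: m₁).reverse ++ t :: k) :=
    ⟨r, m₁, t, k, rfl, hrt, rfl⟩
  obtain ⟨s, hs⟩ : ∃ s, (r :: m₁).getLast? = some s :=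
    ⟨_, List.getLast?_eq_some_getLast (List.cons_ne_nil r m₁)⟩
  -- Rotating at `t` makes its predecessor `s` an end, yet by the invariant `s` is next to `t` on
  -- `l`.
  refine hST s ⟨_, hl'.tail hrot, ?_⟩ ?_
  · rw [List.head?_append, List.head?_reverse, hs]
    simp
  · have := key _ hl'
    rw [← List.cons_append, List.isChain_append] at this
    exact this.2.2 s hs t (by simp)

variable [Fintype V]

/-- The pivot `t` is not the last vertex, as `r t` would then close the path; so the last two
vertices lie in the part that stays fixed. -/
theorem IsRotation.suffix (hcard : 3 ≤ Fintype.card V) (htough : IsTough 2 G)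
    (hham : ¬ G.IsHamiltonian) {l l' : List V} (hl : IsLongestPath G l) (h : IsRotation G l l')
    {a b : V} (hs : [b, a] <:+ l) : [b, a] <:+ l' := by
  obtain ⟨r, m, t, k, rfl, hrt, rfl⟩ := h
  have hk : k ≠ [] := by
    rintro rfl
    exact hl.not_adj_head_getLast hcard htough hham (x := r) (y := t) (by simp)
      (by rw [List.getLast?_append]; simp) hrt
  have hlen : [b, a].length ≤ (t :: k).length := by
    have := List.length_pos_iff.2 hk
    simp only [List.length_cons, List.length_nil]
    omega
  exact (List.suffix_of_suffix_length_le hs (List.suffix_append _ _) hlen).trans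
    (List.suffix_append _ _)

theorem IsLongestPath.suffix_of_rotations (hcard : 3 ≤ Fintype.card V) (htough : IsTough 2 G)
    (hham : ¬ G.IsHamiltonian) {l l' : List V} (hl : IsLongestPath G l)
    (h : Relation.ReflTransGen (IsRotation G) l l') {a b : V} (hs : [b, a] <:+ l) :
    [b, a] <:+ l' := by
  induction h with
  | refl => exact hs
  | tail h₁ h₂ ih => exact h₂.suffix hcard htough hham (hl.of_rotations h₁) ih

theorem IsLongestPath.not_adj_of_mem_rotationEnds (hcard : 3 ≤ Fintype.card V)
    (htough : IsTough 2 G) (hham : ¬ G.IsHamiltonian) {l : List V} (hl : IsLongestPath G l)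
    {a b r : V} (hs : [b, a] <:+ l) (hr : r ∈ rotationEnds G l) : r ≠ a ∧ ¬ G.Adj r a := by
  obtain ⟨l', hl', hr⟩ := hr
  have hlong := hl.of_rotations hl'
  obtain ⟨m, rfl⟩ := hl.suffix_of_rotations hcard htough hham hl' hs
  refine ⟨?_, hlong.not_adj_head_getLast hcard htough hham hr (by simp)⟩
  rintro rfl
  have := hlong.1
  cases m with
  | nil => simp_all
  | cons x m =>
    simp only [List.cons_append, List.head?_cons, Option.mem_some_iff] at hr
    simp_all

theorem IsLongestPath.exists_adj_rotationEnds (hcard : 3 ≤ Fintype.card V)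
    (htough : IsTough 2 G) (hham : ¬ G.IsHamiltonian) {l : List V} (hl : IsLongestPath G l)
    {a b : V} (hs : [b, a] <:+ l) :
    ∃ r₁ ∈ rotationEnds G l, ∃ r₂ ∈ rotationEnds G l, G.Adj r₁ r₂ := by
  classical
  by_contra! hind
  set R : Finset V := {v | v ∈ rotationEnds G l} with hR
  set S : Finset V := {v | ∃ r ∈ R, G.Adj r v} with hS
  have hmemR : ∀ v, v ∈ R ↔ v ∈ rotationEnds G l := fun v => by simp [hR]
  have haR : a ∉ R := fun h =>
    (hl.not_adj_of_mem_rotationEnds hcard htough hham hs ((hmemR a).1 h)).1 rfl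
  have hRpos : 0 < R.card := by
    obtain ⟨x, hx⟩ : ∃ x, l.head? = some x := by
      obtain ⟨m, rfl⟩ := hs
      cases m <;> simp
    exact Finset.card_pos.2 ⟨x, (hmemR x).2 ⟨l, .refl, hx⟩⟩
  have hSle : S.card ≤ 2 * R.card := by
    have hsub : S ⊆ R.image l.formPerm ∪ R.image l.formPerm.symm := by
      intro t ht
      obtain ⟨r, hr, hrt⟩ := (Finset.mem_filter.1 ht).2
      rw [hmemR] at hr
      rcases hl.exists_formPerm_of_adj hr hrt with h | ⟨s, hs, rfl | rfl⟩
      · exact absurd hrt (hind r hr t h)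
      · exact Finset.mem_union_left _ (Finset.mem_image_of_mem _ ((hmemR _).2 hs))
      · exact Finset.mem_union_right _ (Finset.mem_image.2 ⟨_, (hmemR _).2 hs, by simp⟩)
    have h1 := Finset.card_le_card hsub
    have h2 := Finset.card_union_le (R.image l.formPerm) (R.image l.formPerm.symm)
    have h3 : (R.image l.formPerm).card ≤ R.card := Finset.card_image_le
    have h4 : (R.image l.formPerm.symm).card ≤ R.card := Finset.card_image_le
    omega
  -- Pósa's lemma alone gives only `|S| ≤ 2|R|`; the extra component of `a` makes this contradict
  -- toughness.
  have := htough.two_mul_card_le_of_forall_neighbor (S := S) (I := insert a R) a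
    (by rw [Finset.card_insert_of_notMem haR]; omega)
    (by
      intro x hx hxS
      obtain ⟨r, hr, hrx⟩ := (Finset.mem_filter.1 hxS).2
      rw [hmemR] at hr
      rcases Finset.mem_insert.1 hx with rfl | hx
      · exact (hl.not_adj_of_mem_rotationEnds hcard htough hham hs hr).2 hrx
      · exact hind r hr x ((hmemR x).1 hx) hrx)
    (by
      intro x hx hxa y hxy
      exact Finset.mem_filter.2 ⟨Finset.mem_univ _, x, Finset.mem_of_mem_insert_of_ne hx hxa, hxy⟩)
  rw [Finset.card_insert_of_notMem haR] at this
  omega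

end Rotation

/-! ### Degree bound for end vertices. -/

section EndDegree

variable {V : Type*} [DecidableEq V] {G : SimpleGraph V}

/-- A list closing up to a cycle can be rotated so that a given vertex comes last. -/
theorem exists_rotated_getLast {c : List V} (hnd : c.Nodup) (hc : c.IsChain G.Adj)
    (hcyc : ∀ x ∈ c.getLast?, ∀ y ∈ c.head?, G.Adj x y) {x : V} (hx : x ∈ c) :
    ∃ c', c ~r c' ∧ c'.IsChain G.Adj ∧ x ∈ c'.getLast? ∧ c.formPerm x ∈ c'.head? := by
  obtain ⟨u, w, rfl⟩ := List.append_of_mem hx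
  have hrot : (u ++ x :: w) ~r (w ++ (u ++ [x])) := by
    have h : u ++ x :: w = (u ++ [x]) ++ w := by simp
    rw [h]
    exact List.isRotated_append
  refine ⟨_, hrot, ?_, by simp, ?_⟩
  · have hc' : ((u ++ [x]) ++ w).IsChain G.Adj := by simpa using hc
    rw [List.isChain_append] at hc' ⊢
    refine ⟨hc'.2.1, hc'.1, fun y hy z hz => hcyc y ?_ z ?_⟩
    · have : u ++ x :: w = (u ++ [x]) ++ w := by simp
      rw [this, List.getLast?_append]
      simp [Option.mem_def.1 hy]
    · have : u ++ x :: w = (u ++ [x]) ++ w := by simp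
      rw [this, List.head?_append]
      simp [Option.mem_def.1 hz]
  · rw [List.formPerm_eq_of_isRotated hnd hrot, ← List.append_assoc]
    cases h : w ++ u with
    | nil => simp
    | cons s m =>
      rw [List.cons_append, List.formPerm_cons_concat_apply_last]
      simp

variable [Fintype V]

/-- Here `c` is a cycle missing only `a` from the path, and `c.formPerm` is its successor map. An
edge among `a` and the successors of its neighbours would produce a longest path with adjacent ends.
-/
theorem IsLongestPath.three_mul_degree_le (hcard : 3 ≤ Fintype.card V)
    (htough : IsTough 2 G) (hham : ¬ G.IsHamiltonian) {c : List V} {a : V} [DecidableRel G.Adj]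
    (hl : IsLongestPath G (c ++ [a]))
    (hcyc : ∀ x ∈ c.getLast?, ∀ y ∈ c.head?, G.Adj x y) :
    3 * (G.degree a + 1) ≤ Fintype.card V := by
  have hnd : c.Nodup := (List.nodup_append.1 hl.1).1
  have hac : a ∉ c := fun h => (List.nodup_append.1 hl.1).2.2 a h a (by simp) rfl
  have hch : c.IsChain G.Adj := (List.isChain_append.1 hl.2.1).1
  have hN : ∀ x, G.Adj a x → x ∈ c := fun x hx => by
    have := hl.mem_of_adj_getLast (x := a) (by simp) hx
    rw [List.mem_append, List.mem_singleton] at this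
    exact this.resolve_right hx.ne'
  have hpath : ∀ (c' : List V), c.Perm c' → c'.IsChain G.Adj → (∀ x ∈ c'.getLast?, G.Adj a x) →
      IsLongestPath G (c' ++ [a]) := fun c' hp hc' hx =>
    hl.of_perm (hp.symm.append_right _) (List.isChain_append.2 ⟨hc', by simp, by
      intro x hx' y hy
      simp only [List.head?_cons, Option.mem_some_iff] at hy
      exact hy ▸ (hx x hx').symm⟩)
  have hclose : ∀ (c' : List V), IsLongestPath G (c' ++ [a]) → ∀ y ∈ c'.head?, ¬ G.Adj y a :=
    fun c' hc' y hy => hc'.not_adj_head_getLast hcard htough hham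
      (by rw [List.head?_append]; simp [Option.mem_def.1 hy]) (by simp)
  have hsucc : ∀ x, G.Adj a x → ¬ G.Adj (c.formPerm x) a := by
    intro x hx
    obtain ⟨c', hrot, hc', hxl, hxh⟩ := exists_rotated_getLast hnd hch hcyc (hN x hx)
    exact hclose c' (hpath c' hrot.perm hc' fun y hy => Option.mem_unique hxl hy ▸ hx) _ hxh
  have hsucc₂ : ∀ x y, G.Adj a x → G.Adj a y → ¬ G.Adj (c.formPerm x) (c.formPerm y) := by
    intro x y hx hy hxy
    have hne : y ≠ x := by rintro rfl; exact hxy.ne rfl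
    obtain ⟨c', hrot, hc', hxl, hxh⟩ := exists_rotated_getLast hnd hch hcyc (hN x hx)
    obtain ⟨u, w, rfl⟩ := List.append_of_mem (hrot.mem_iff.1 (hN y hy))
    cases w with
    | nil =>
      refine hne ?_
      simpa using hxl
    | cons z w =>
      have hrot' : c ~r (z :: (w ++ u ++ [y])) := by
        refine hrot.trans ?_
        have h : u ++ y :: z :: w = (u ++ [y]) ++ (z :: w) := by simp
        have h' : z :: (w ++ u ++ [y]) = (z :: w) ++ (u ++ [y]) := by simp
        rw [h, h']
        exact List.isRotated_append
      have hz : c.formPerm y = z := by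
        rw [List.formPerm_eq_of_isRotated hnd hrot', List.formPerm_cons_concat_apply_last]
      have h : u ++ y :: z :: w = (u ++ [y]) ++ (z :: w) := by simp
      rw [h] at hrot hc' hxl hxh
      have hc'' := List.isChain_append.1 hc'
      -- With `x⁺, y⁺` the successors, the cycle reads `x⁺ … y y⁺ … x`; the chord `x⁺y⁺` gives the
      -- path `y … x⁺ y⁺ … x a`, whose ends are adjacent.
      refine hclose ((u ++ [y]).reverse ++ (z :: w)) (hpath _ ?_ ?_ ?_) y (by simp) hy.symm
      · exact hrot.perm.trans ((List.reverse_perm _).symm.append_right _)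
      · refine List.isChain_append.2 ⟨?_, hc''.2.1, ?_⟩
        · rw [List.isChain_reverse]
          exact hc''.1.imp fun _ _ h => h.symm
        · intro p hp q hq
          have hp' : c.formPerm x = p := by
            refine Option.mem_unique hxh ?_
            rw [List.getLast?_reverse] at hp
            rw [List.head?_append, Option.mem_def.1 hp]
            simp
          have hq' : z = q := by simpa using hq
          rw [← hp', ← hq', ← hz]
          exact hxy
      · intro p hp
        rw [List.getLast?_append] at hp hxl
        have hw : ∃ v, (z :: w).getLast? = some v :=
          ⟨_, List.getLast?_eq_some_getLast (List.cons_ne_nil z w)⟩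
        obtain ⟨v, hv⟩ := hw
        rw [hv] at hp hxl
        simp only [Option.some_or, Option.mem_some_iff] at hp hxl
        rw [← hp, hxl]
        exact hx
  have haI : a ∉ (G.neighborFinset a).image c.formPerm := by
    intro h
    obtain ⟨x, hx, hxa⟩ := Finset.mem_image.1 h
    rw [mem_neighborFinset] at hx
    exact hac (hxa ▸ List.formPerm_apply_mem_of_mem (hN x hx))
  have := htough.three_mul_card_le hcard (I := insert a ((G.neighborFinset a).image c.formPerm)) (by
    intro p hp q hq
    simp only [Finset.mem_insert, Finset.mem_image, mem_neighborFinset] at hp hq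
    rcases hp with rfl | ⟨x, hx, rfl⟩ <;> rcases hq with rfl | ⟨y, hy, rfl⟩
    · exact G.irrefl
    · exact fun h => hsucc y hy h.symm
    · exact hsucc x hx
    · exact hsucc₂ x y hx hy)
  rwa [Finset.card_insert_of_notMem haI, Finset.card_image_of_injective _ c.formPerm.injective,
    card_neighborFinset_eq_degree] at this

theorem IsLongestPath.three_mul_degree_getLast_le (hcard : 3 ≤ Fintype.card V)
    (htough : IsTough 2 G) (hfree : IsTwoKTwoFree G) (hham : ¬ G.IsHamiltonian) {l : List V}
    {a b : V} [DecidableRel G.Adj] (hl : IsLongestPath G l) (hs : [b, a] <:+ l) :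
    3 * (G.degree a + 1) ≤ Fintype.card V := by
  have hends := fun r hr =>
    hl.not_adj_of_mem_rotationEnds (r := r) hcard htough hham hs hr
  have hba : G.Adj b a := by
    obtain ⟨m, rfl⟩ := hs
    simpa using (List.isChain_append.1 hl.2.1).2.1
  obtain ⟨r, hr, hrb⟩ : ∃ r ∈ rotationEnds G l, G.Adj r b := by
    obtain ⟨r₁, h₁, r₂, h₂, h₁₂⟩ := hl.exists_adj_rotationEnds hcard htough hham hs
    have hb : ∀ r ∈ rotationEnds G l, b ≠ r := fun r hr h => (hends r hr).2 (h ▸ hba)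
    rcases hfree.adj_of_adj hba.symm h₁₂ (hends _ h₁).1.symm (hends _ h₂).1.symm
      (hb _ h₁) (hb _ h₂) with h | h | h | h
    · exact absurd h.symm (hends _ h₁).2
    · exact absurd h.symm (hends _ h₂).2
    · exact ⟨_, h₁, h.symm⟩
    · exact ⟨_, h₂, h.symm⟩
  obtain ⟨l', hl', hrl'⟩ := hr
  obtain ⟨m, hm⟩ := hl.suffix_of_rotations hcard htough hham hl' hs
  obtain rfl : (m ++ [b]) ++ [a] = l' := by simpa using hm
  refine (hl.of_rotations hl').three_mul_degree_le hcard htough hham ?_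
  intro x hx y hy
  have hx' : b = x := by simpa using hx
  have hy' : r = y := by
    refine Option.mem_unique hrl' ?_
    rw [List.head?_append, Option.mem_def.1 hy]
    simp
  rw [← hx', ← hy']
  exact hrb.symm

end EndDegree

/-! ### The final count. -/

theorem theorem1p6 {V : Type*} [Fintype V] [DecidableEq V] (G : SimpleGraph V)
    (hcard : 3 ≤ Fintype.card V) (htough : IsTough 2 G) (hfree : IsTwoKTwoFree G) :
    G.IsHamiltonian := by
  classical
  by_contra hham
  obtain ⟨l, hl⟩ := IsLongestPath.exists_of_fintype G
  have hlen : 2 ≤ l.length := by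
    by_contra! hlt
    have := htough.three_mul_card_le hcard (I := Finset.univ) (by
      intro x _ y _ hxy
      have := hl.2.2 [x, y] (by simp [hxy.ne]) (by simp [hxy])
      simp only [List.length_cons, List.length_nil] at this
      omega)
    rw [Finset.card_univ] at this
    omega
  have hsuffix : ∀ k : List V, 2 ≤ k.length → ∃ b a, [b, a] <:+ k := by
    intro k hk
    have : (k.drop (k.length - 2)).length = 2 := by
      rw [List.length_drop]; omega
    obtain ⟨b, a, h⟩ := List.length_eq_two.1 this
    exact ⟨b, a, h ▸ List.drop_suffix _ _⟩
  obtain ⟨b, a, hs⟩ := hsuffix l hlen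
  obtain ⟨r₁, h₁, r₂, h₂, hr⟩ := hl.exists_adj_rotationEnds hcard htough hham hs
  -- Reversing a rotated path puts its end `r` last, where the degree bound applies.
  have hdeg : ∀ r ∈ rotationEnds G l, 3 * (G.degree r + 1) ≤ Fintype.card V := by
    rintro r ⟨l', hl', hrl'⟩
    have hlong := (hl.of_rotations hl').reverse
    obtain ⟨d, e, hde⟩ := hsuffix l'.reverse (by
      rw [List.length_reverse]
      exact hlen.trans ((hl.of_rotations hl').2.2 l hl.1 hl.2.1))
    have he : e = r := by
      refine Option.mem_unique (a := e) (o := l'.reverse.getLast?) ?_ (by simpa using hrl')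
      obtain ⟨m, hm⟩ := hde
      simp [← hm]
    exact he ▸ hlong.three_mul_degree_getLast_le hcard htough hfree hham hde
  have hd₁ := hdeg r₁ h₁
  have hd₂ := hdeg r₂ h₂
  set Z : Finset V := (G.neighborFinset r₁ ∪ G.neighborFinset r₂)ᶜ with hZ
  have hZmem : ∀ v, v ∈ Z ↔ ¬ G.Adj r₁ v ∧ ¬ G.Adj r₂ v := fun v => by simp [hZ]
  have hZind := htough.three_mul_card_le hcard (I := Z) (by
    intro x hx y hy hxy
    rw [hZmem] at hx hy
    have hne : ∀ v, ¬ G.Adj r₁ v ∧ ¬ G.Adj r₂ v → r₁ ≠ v ∧ r₂ ≠ v := fun v hv =>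
      ⟨by rintro rfl; exact hv.2 hr.symm, by rintro rfl; exact hv.1 hr⟩
    have := hfree.adj_of_adj hr hxy (hne x hx).1 (hne y hy).1 (hne x hx).2 (hne y hy).2
    tauto)
  have hunion := Finset.card_union_le (G.neighborFinset r₁) (G.neighborFinset r₂)
  have hcompl := Finset.card_add_card_compl (G.neighborFinset r₁ ∪ G.neighborFinset r₂)
  rw [← hZ] at hcompl
  rw [card_neighborFinset_eq_degree, card_neighborFinset_eq_degree] at hunion
  omega
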